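/- Let $\mathcal H$ be an infinite-dimensional separable complex Hilbert space, let $\mathcal B^1(\mathcal H)$ be the space of trace-class operators on $\mathcal H$ with the trace norm $\nu_1(A)=\operatorname{tr}\sqrt{A^\dagger A}$, and let $\mathcal B(\mathcal B^1(\mathcal H))$ be the algebra of bounded linear operators on this normed space. A linear map $T:\mathcal B^1(\mathcal H)\to\mathcal B^1(\mathcal H)$ is called completely positive if for every $n\in\mathbb N$ the map $T\otimes\operatorname{id}_n:\mathcal B^1(\mathcal H\otimes\mathbb C^n)\to\mathcal B^1(\mathcal H\otimes\mathbb C^n)$ sends positive semi-definite operators to positive semi-definite operators, and trace-preserving if $\operatorname{tr}(T(A))=\operatorname{tr}(A)$ for all $A\in\mathcal B^1(\mathcal H)$. Let $Q_S(\mathcal H)$ be the set of all linear, completely positive and trace-preserving maps $T:\mathcal B^1(\mathcal H)\to\mathcal B^1(\mathcal H)$ (Schrödinger quantum channels); boundedness is not part of this definition. Then every $T\in Q_S(\mathcal H)$ is bounded, and $Q_S(\mathcal H)$ is a convex subsemigroup (under composition) of $\mathcal B(\mathcal B^1(\mathcal H))$ with unity element $\operatorname{id}_{\mathcal B^1(\mathcal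 H)}$. Moreover, $Q_S(\mathcal H)$ is closed in $\mathcal B(\mathcal B^1(\mathcal H))$ with respect to the weak operator topology (induced by the seminorms $T\mapsto|y(T(A))|$ with $A\in\mathcal B^1(\mathcal H)$ and $y$ in the dual space $\mathcal B^1(\mathcal H)'$), the strong operator topology (induced by the seminorms $T\mapsto\nu_1(T(A))$ with $A\in\mathcal B^1(\mathcal H)$) and the uniform operator topology (induced by the operator norm). -/

import Mathlib

open scoped ENNReal InnerProductSpace

set_option linter.unusedSectionVars false

noncomputable section

namespace QuantumChannel

universe u v

variable {H : Type u} [NormedAddCommGroup H] [InnerProductSpace ℂ H] [CompleteSpace H]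
variable {K : Type v} [NormedAddCommGroup K] [InnerProductSpace ℂ K] [CompleteSpace K]

/-! ### Trace-class operators: definition -/

/-- `A` is trace class if `∑ i, ⟪e i, √(A† A) (e i)⟫` is summable for some orthonormal basis `e`.
(`CFC.abs A` is `√(A† A)`; every orthonormal basis can be indexed by a subset of `H`: the set of its members.) -/
def IsTraceClass (A : H →L[ℂ] H) : Prop :=
  ∃ (w : Set H) (e : HilbertBasis w ℂ H), Summable fun i => ⟪e i, CFC.abs A (e i)⟫_ℂ

variable (H) in
/-- The index set of a chosen orthonormal basis of `H`. -/
def basisIndex : Set H := (exists_hilbertBasis ℂ H).choose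

variable (H) in
/-- A chosen orthonormal basis of `H`. The values of the trace and of the trace norm do not depend
on it, see `hasSum_trace` and `hasSum_norm` below. -/
def chosenBasis : HilbertBasis (basisIndex H) ℂ H := (exists_hilbertBasis ℂ H).choose_spec.choose

/-! ### Auxiliary facts: Hilbert-Schmidt sums -/

/-- The sum `∑ i, ‖T (e i)‖ ^ 2` in `[0, ∞]`. -/
def hsSum {ι : Type*} (T : H →L[ℂ] K) (e : HilbertBasis ι ℂ H) : ℝ≥0∞ := ∑' i, ‖T (e i)‖ₑ ^ 2

lemma tsum_enorm_inner_sq {ι : Type*} (e : HilbertBasis ι ℂ H) (x : H) :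
    ∑' i, ‖⟪e i, x⟫_ℂ‖ₑ ^ 2 = ‖x‖ₑ ^ 2 := by
  have h := e.hasSum_inner_mul_inner x x
  have h2 : HasSum (fun i => ‖⟪e i, x⟫_ℂ‖ ^ 2) (‖x‖ ^ 2) := by
    have := Complex.hasSum_re h
    convert this using 1
    · ext i
      rw [← inner_conj_symm x (e i), mul_comm, Complex.mul_conj, Complex.normSq_eq_norm_sq]
      rw [Complex.ofReal_re]
    · rw [inner_self_eq_norm_sq_to_K]
      norm_cast
  have h3 := (ENNReal.ofReal_tsum_of_nonneg (fun i => sq_nonneg ‖⟪e i, x⟫_ℂ‖) h2.summable)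
  rw [h2.tsum_eq] at h3
  simp only [ENNReal.ofReal_pow (norm_nonneg _), ofReal_norm] at h3
  exact h3.symm

lemma hsSum_adjoint {ι κ : Type*} (T : H →L[ℂ] K) (e : HilbertBasis ι ℂ H)
    (f : HilbertBasis κ ℂ K) : hsSum T e = hsSum T.adjoint f := by
  unfold hsSum
  calc ∑' i, ‖T (e i)‖ₑ ^ 2 = ∑' i, ∑' j, ‖⟪f j, T (e i)⟫_ℂ‖ₑ ^ 2 := by
        simp_rw [tsum_enorm_inner_sq]
    _ = ∑' j, ∑' i, ‖⟪f j, T (e i)⟫_ℂ‖ₑ ^ 2 := ENNReal.tsum_comm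
    _ = ∑' j, ∑' i, ‖⟪e i, T.adjoint (f j)⟫_ℂ‖ₑ ^ 2 := by
        refine tsum_congr fun j => tsum_congr fun i => ?_
        rw [ContinuousLinearMap.adjoint_inner_right, ← inner_conj_symm]
        simp only [RCLike.enorm_conj]
    _ = _ := by simp_rw [tsum_enorm_inner_sq]

lemma hsSum_basis {ι κ : Type*} (T : H →L[ℂ] K) (e : HilbertBasis ι ℂ H)
    (f : HilbertBasis κ ℂ H) : hsSum T e = hsSum T f := by
  rw [hsSum_adjoint T e (chosenBasis K), ← hsSum_adjoint T f (chosenBasis K)]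

lemma hsSum_comp_le {ι : Type*} {L : Type*} [NormedAddCommGroup L] [InnerProductSpace ℂ L]
    [CompleteSpace L] (X : K →L[ℂ] L) (T : H →L[ℂ] K) (e : HilbertBasis ι ℂ H) :
    hsSum (X ∘L T) e ≤ ‖X‖ₑ ^ 2 * hsSum T e := by
  unfold hsSum
  rw [← ENNReal.tsum_mul_left]
  refine ENNReal.tsum_le_tsum fun i => ?_
  rw [← mul_pow]
  gcongr
  exact X.le_opENorm _

lemma hsSum_ne_top_hasSum {ι : Type*} (T : H →L[ℂ] K) (e : HilbertBasis ι ℂ H)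
    (h : hsSum T e ≠ ∞) : HasSum (fun i => ‖T (e i)‖ ^ 2) (hsSum T e).toReal := by
  have h1 : ∀ i, ‖T (e i)‖ₑ ^ 2 ≠ ∞ := fun i => by finiteness
  have := ENNReal.hasSum_toReal h
  convert this using 1
  · ext i; simp
  · unfold hsSum; rw [ENNReal.tsum_toReal_eq h1]

/-! ### Auxiliary facts: polar decomposition -/

/-- `√|A|`. -/
def sqrtAbs (A : H →L[ℂ] H) : H →L[ℂ] H := CFC.sqrt (CFC.abs A)

lemma sqrtAbs_adjoint (A : H →L[ℂ] H) : (sqrtAbs A).adjoint = sqrtAbs A := by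
  rw [← ContinuousLinearMap.star_eq_adjoint]
  exact (CFC.sqrt_nonneg (CFC.abs A)).star_eq

lemma sqrtAbs_apply (A : H →L[ℂ] H) (x : H) : sqrtAbs A (sqrtAbs A x) = CFC.abs A x := by
  rw [← CFC.sqrt_mul_sqrt_self (CFC.abs A) (CFC.abs_nonneg A)]; rfl

lemma inner_abs (A : H →L[ℂ] H) (x : H) : ⟪x, CFC.abs A x⟫_ℂ = (‖sqrtAbs A x‖ ^ 2 : ℝ) := by
  rw [← sqrtAbs_apply, ← ContinuousLinearMap.adjoint_inner_left, sqrtAbs_adjoint,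
    inner_self_eq_norm_sq_to_K]
  norm_cast

lemma inner_abs_abs (A : H →L[ℂ] H) (x y : H) :
    ⟪CFC.abs A x, CFC.abs A y⟫_ℂ = ⟪A x, A y⟫_ℂ := by
  have h : CFC.abs A (CFC.abs A y) = A.adjoint (A y) := by
    have := congrArg (fun T : H →L[ℂ] H => T y) (CFC.abs_mul_abs A)
    exact this
  have h2 : (CFC.abs A).adjoint = CFC.abs A := by
    rw [← ContinuousLinearMap.star_eq_adjoint]
    exact (CFC.abs_nonneg A).star_eq
  rw [← ContinuousLinearMap.adjoint_inner_right A, ← h,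
    ← ContinuousLinearMap.adjoint_inner_right (CFC.abs A) x, h2]

lemma norm_abs_apply (A : H →L[ℂ] H) (x : H) : ‖CFC.abs A x‖ = ‖A x‖ := by
  have h := inner_abs_abs A x x
  rw [inner_self_eq_norm_sq_to_K, inner_self_eq_norm_sq_to_K] at h
  have h2 : ‖CFC.abs A x‖ ^ 2 = ‖A x‖ ^ 2 := by exact_mod_cast h
  exact (sq_eq_sq₀ (norm_nonneg _) (norm_nonneg _)).1 h2

lemma exists_polar (A : H →L[ℂ] H) : ∃ W : H →L[ℂ] H, ‖W‖ ≤ 1 ∧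
    (∀ x, W (CFC.abs A x) = A x) ∧ (∀ x, W.adjoint (A x) = CFC.abs A x) := by
  let R : Submodule ℂ H := (LinearMap.range (CFC.abs A).toLinearMap).topologicalClosure
  have hR : ∀ x, CFC.abs A x ∈ R := fun x =>
    Submodule.le_topologicalClosure _ (LinearMap.mem_range_self (CFC.abs A).toLinearMap x)
  have : CompleteSpace R := (Submodule.isClosed_topologicalClosure _).completeSpace_coe
  let P : H →ₗ[ℂ] R := (CFC.abs A).toLinearMap.codRestrict R hR
  have hP : DenseRange P := by
    intro u
    have hu : (u : H) ∈ closure (Set.range fun x => CFC.abs A x) := u.2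
    rw [closure_subtype]
    convert hu using 2
    ext y
    constructor
    · rintro ⟨_, ⟨x, rfl⟩, rfl⟩
      exact ⟨x, rfl⟩
    · rintro ⟨x, rfl⟩
      exact ⟨P x, ⟨x, rfl⟩, rfl⟩
  have hn : ∀ x, ‖A.toLinearMap x‖ ≤ 1 * ‖P x‖ := fun x => by
    rw [one_mul]; exact (norm_abs_apply A x).ge
  let W₀ : R →L[ℂ] H := A.toLinearMap.extendOfNorm P
  have hW₀ : ∀ x, W₀ (P x) = A x := fun x => LinearMap.extendOfNorm_eq hP ⟨1, hn⟩ x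
  have hW₀n : ‖W₀‖ ≤ 1 := LinearMap.opNorm_extendOfNorm_le hP zero_le_one hn
  have hproj : ∀ x, R.orthogonalProjectionOnto (CFC.abs A x) = P x := fun x =>
    R.orthogonalProjectionOnto_mem_subspace_eq_self (P x)
  refine ⟨W₀ ∘L R.orthogonalProjectionOnto, ?_, fun x => ?_, fun x => ?_⟩
  · refine (ContinuousLinearMap.opNorm_comp_le _ _).trans ?_
    exact mul_le_one₀ hW₀n (norm_nonneg _) R.orthogonalProjectionOnto_norm_le
  · rw [ContinuousLinearMap.comp_apply, hproj, hW₀]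
  · refine ext_inner_left ℂ fun y => ?_
    rw [ContinuousLinearMap.adjoint_inner_right, ContinuousLinearMap.comp_apply]
    have key : ∀ u : R, ⟪W₀ u, A x⟫_ℂ = ⟪u, P x⟫_ℂ := by
      intro u
      refine hP.induction_on (p := fun u => ⟪W₀ u, A x⟫_ℂ = ⟪u, P x⟫_ℂ) u ?_ ?_
      · exact isClosed_eq (by fun_prop) (by fun_prop)
      · intro z
        rw [hW₀]
        exact (inner_abs_abs A z x).symm
    rw [key]
    exact R.inner_orthogonalProjectionOnto_eq_of_mem_right (P x) y

/-! ### Auxiliary facts: trace-class operators -/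

lemma exists_factor {ι κ : Type*} (A : H →L[ℂ] H) (X : H →L[ℂ] K) (Y : K →L[ℂ] H)
    (b : HilbertBasis ι ℂ K) (c : HilbertBasis κ ℂ H) :
    ∃ P Q : K →L[ℂ] H, (∀ x, ⟪x, X (A (Y x))⟫_ℂ = ⟪P x, Q x⟫_ℂ) ∧
      hsSum P b ≤ ‖X‖ₑ ^ 2 * hsSum (sqrtAbs A) c ∧
      hsSum Q b ≤ ‖Y‖ₑ ^ 2 * hsSum (sqrtAbs A) c := by
  obtain ⟨W, hW, hWA, -⟩ := exists_polar A
  refine ⟨(X ∘L W ∘L sqrtAbs A).adjoint, sqrtAbs A ∘L Y, fun x => ?_, ?_, ?_⟩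
  · rw [ContinuousLinearMap.adjoint_inner_left]
    simp [sqrtAbs_apply, hWA]
  · rw [← hsSum_adjoint _ c]
    have h := hsSum_comp_le (X ∘L W) (sqrtAbs A) c
    refine h.trans ?_
    gcongr
    refine enorm_le_iff_norm_le.2 ((ContinuousLinearMap.opNorm_comp_le _ _).trans ?_)
    exact mul_le_of_le_one_right (norm_nonneg _) hW
  · rw [hsSum_adjoint _ b c, ContinuousLinearMap.adjoint_comp, sqrtAbs_adjoint]
    refine (hsSum_comp_le _ (sqrtAbs A) c).trans ?_
    gcongr
    exact enorm_le_iff_norm_le.2 (LinearIsometryEquiv.norm_map _ _).le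

lemma two_mul_enorm_inner_le (x y : H) : 2 * ‖⟪x, y⟫_ℂ‖ₑ ≤ ‖x‖ₑ ^ 2 + ‖y‖ₑ ^ 2 := by
  have h : 2 * ‖⟪x, y⟫_ℂ‖ ≤ ‖x‖ ^ 2 + ‖y‖ ^ 2 := by
    nlinarith [norm_inner_le_norm (𝕜 := ℂ) x y, sq_nonneg (‖x‖ - ‖y‖)]
  have h2 := ENNReal.ofReal_le_ofReal h
  rwa [ENNReal.ofReal_mul zero_le_two, ENNReal.ofReal_add (sq_nonneg _) (sq_nonneg _),
    ENNReal.ofReal_pow (norm_nonneg _), ENNReal.ofReal_pow (norm_nonneg _), ofReal_norm,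
    ofReal_norm, ofReal_norm, ENNReal.ofReal_ofNat] at h2

lemma two_mul_tsum_le {ι κ : Type*} (A : H →L[ℂ] H) (X : H →L[ℂ] K) (Y : K →L[ℂ] H)
    (b : HilbertBasis ι ℂ K) (c : HilbertBasis κ ℂ H) :
    2 * ∑' i, ‖⟪b i, X (A (Y (b i)))⟫_ℂ‖ₑ ≤
      (‖X‖ₑ ^ 2 + ‖Y‖ₑ ^ 2) * hsSum (sqrtAbs A) c := by
  obtain ⟨P, Q, hPQ, hP, hQ⟩ := exists_factor A X Y b c
  calc 2 * ∑' i, ‖⟪b i, X (A (Y (b i)))⟫_ℂ‖ₑ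
      = ∑' i, 2 * ‖⟪P (b i), Q (b i)⟫_ℂ‖ₑ := by
        rw [ENNReal.tsum_mul_left]; simp_rw [hPQ]
    _ ≤ ∑' i, (‖P (b i)‖ₑ ^ 2 + ‖Q (b i)‖ₑ ^ 2) :=
        ENNReal.tsum_le_tsum fun i => two_mul_enorm_inner_le _ _
    _ = hsSum P b + hsSum Q b := ENNReal.tsum_add
    _ ≤ _ := by rw [add_mul]; exact add_le_add hP hQ

lemma hsSum_sqrtAbs {ι : Type*} (A : H →L[ℂ] H) (e : HilbertBasis ι ℂ H) :
    hsSum (sqrtAbs A) e = ∑' i, ‖⟪e i, CFC.abs A (e i)⟫_ℂ‖ₑ := by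
  unfold hsSum
  refine tsum_congr fun i => ?_
  rw [inner_abs, ← ofReal_norm, ← ofReal_norm, Complex.norm_real, Real.norm_eq_abs, abs_sq,
    ENNReal.ofReal_pow (norm_nonneg _)]

lemma isTraceClass_iff {ι : Type*} (A : H →L[ℂ] H) (e : HilbertBasis ι ℂ H) :
    IsTraceClass A ↔ hsSum (sqrtAbs A) e ≠ ∞ := by
  have key : ∀ {κ : Type u} (f : HilbertBasis κ ℂ H),
      (Summable fun i => ⟪f i, CFC.abs A (f i)⟫_ℂ) ↔ hsSum (sqrtAbs A) e ≠ ∞ := by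
    intro κ f
    rw [hsSum_basis _ e f, hsSum_sqrtAbs]
    constructor
    · intro h
      have := h.norm
      rw [← lt_top_iff_ne_top]
      simpa [← ofReal_norm] using this.tsum_ofReal_lt_top
    · intro h
      refine Summable.of_norm ?_
      have := ENNReal.summable_toReal h
      simpa using this
  constructor
  · rintro ⟨w, f, hf⟩
    exact (key f).1 hf
  · intro h
    exact ⟨_, chosenBasis H, (key (chosenBasis H)).2 h⟩

lemma hsSum_sqrtAbs_add_le {ι : Type*} (A B : H →L[ℂ] H) (e : HilbertBasis ι ℂ H) :
    hsSum (sqrtAbs (A + B)) e ≤ hsSum (sqrtAbs A) e + hsSum (sqrtAbs B) e := by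
  obtain ⟨W, hW, -, hWC⟩ := exists_polar (A + B)
  have hone : ∀ T : H →L[ℂ] H, ∑' i, ‖⟪e i, W.adjoint (T (e i))⟫_ℂ‖ₑ ≤ hsSum (sqrtAbs T) e := by
    intro T
    have h := two_mul_tsum_le T W.adjoint (.id ℂ H) e e
    have h1 : ‖W.adjoint‖ₑ ≤ 1 := by
      have : ‖W.adjoint‖ ≤ 1 := (LinearIsometryEquiv.norm_map _ _).le.trans hW
      simpa [← ofReal_norm] using this
    have h2 : ‖ContinuousLinearMap.id ℂ H‖ₑ ≤ 1 := by
      have : ‖ContinuousLinearMap.id ℂ H‖ ≤ 1 := ContinuousLinearMap.norm_id_le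
      simpa [← ofReal_norm] using this
    have h3 : (‖W.adjoint‖ₑ ^ 2 + ‖ContinuousLinearMap.id ℂ H‖ₑ ^ 2) ≤ 2 := by
      calc _ ≤ (1 : ℝ≥0∞) ^ 2 + 1 ^ 2 := by gcongr
        _ = 2 := by norm_num
    have h4 := h.trans (mul_le_mul_left h3 (hsSum (sqrtAbs T) e))
    exact (ENNReal.mul_le_mul_iff_right two_ne_zero ENNReal.ofNat_ne_top).1 h4
  calc hsSum (sqrtAbs (A + B)) e
      = ∑' i, ‖⟪e i, W.adjoint (A (e i))⟫_ℂ + ⟪e i, W.adjoint (B (e i))⟫_ℂ‖ₑ := by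
        rw [hsSum_sqrtAbs]
        refine tsum_congr fun i => ?_
        rw [← hWC, ← inner_add_right, ← map_add]; rfl
    _ ≤ ∑' i, (‖⟪e i, W.adjoint (A (e i))⟫_ℂ‖ₑ + ‖⟪e i, W.adjoint (B (e i))⟫_ℂ‖ₑ) :=
        ENNReal.tsum_le_tsum fun i => enorm_add_le _ _
    _ = _ := ENNReal.tsum_add
    _ ≤ _ := add_le_add (hone A) (hone B)

lemma IsTraceClass.sandwich {A : H →L[ℂ] H} (hA : IsTraceClass A) (X : H →L[ℂ] K)
    (Y : K →L[ℂ] H) : IsTraceClass (X ∘L A ∘L Y) := by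
  obtain ⟨W, hW, -, hWC⟩ := exists_polar (X ∘L A ∘L Y)
  rw [isTraceClass_iff _ (chosenBasis H)] at hA
  rw [isTraceClass_iff _ (chosenBasis K), hsSum_sqrtAbs]
  have h := two_mul_tsum_le A (W.adjoint ∘L X) Y (chosenBasis K) (chosenBasis H)
  have h2 : (‖W.adjoint ∘L X‖ₑ ^ 2 + ‖Y‖ₑ ^ 2) * hsSum (sqrtAbs A) (chosenBasis H) ≠ ∞ := by
    finiteness
  have h3 := ne_top_of_le_ne_top h2 h
  simp_rw [← hWC]
  intro h4
  apply h3
  simp only [ContinuousLinearMap.comp_apply] at h4 ⊢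
  rw [h4]
  exact ENNReal.mul_top two_ne_zero

lemma sqrtAbs_zero : sqrtAbs (0 : H →L[ℂ] H) = 0 := by
  unfold sqrtAbs; simp

lemma hsSum_sqrtAbs_smul {ι : Type*} (c : ℂ) (A : H →L[ℂ] H) (e : HilbertBasis ι ℂ H) :
    hsSum (sqrtAbs (c • A)) e = ‖c‖ₑ * hsSum (sqrtAbs A) e := by
  rw [hsSum_sqrtAbs, hsSum_sqrtAbs, ← ENNReal.tsum_mul_left]
  refine tsum_congr fun i => ?_
  rw [CFC.abs_smul, smul_apply, inner_smul_right_eq_smul, enorm_smul]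
  simp

lemma isTraceClass_zero : IsTraceClass (0 : H →L[ℂ] H) := by
  rw [isTraceClass_iff _ (chosenBasis H), sqrtAbs_zero]
  simp [hsSum]

lemma IsTraceClass.add {A B : H →L[ℂ] H} (hA : IsTraceClass A) (hB : IsTraceClass B) :
    IsTraceClass (A + B) := by
  rw [isTraceClass_iff _ (chosenBasis H)] at *
  exact ne_top_of_le_ne_top (ENNReal.add_ne_top.2 ⟨hA, hB⟩) (hsSum_sqrtAbs_add_le A B _)

lemma IsTraceClass.smul {A : H →L[ℂ] H} (c : ℂ) (hA : IsTraceClass A) :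
    IsTraceClass (c • A) := by
  rw [isTraceClass_iff _ (chosenBasis H)] at *
  rw [hsSum_sqrtAbs_smul]
  finiteness

/-! ### The normed space of trace-class operators -/

variable (H) in
/-- The trace-class operators as a subspace of the bounded operators. -/
def traceClassSubmodule : Submodule ℂ (H →L[ℂ] H) where
  carrier := {A | IsTraceClass A}
  zero_mem' := isTraceClass_zero
  add_mem' := IsTraceClass.add
  smul_mem' c _ := IsTraceClass.smul c

variable (H) in
/-- The space of trace-class operators on `H`. This is a type of its own, since it carries the
trace norm and not the operator norm. -/
def TraceClass : Type u := traceClassSubmodule H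

namespace TraceClass

instance : AddCommGroup (TraceClass H) := inferInstanceAs (AddCommGroup (traceClassSubmodule H))

instance : Module ℂ (TraceClass H) := inferInstanceAs (Module ℂ (traceClassSubmodule H))

variable (H) in
/-- The inclusion of the trace-class operators into the bounded operators. -/
def incl : TraceClass H →ₗ[ℂ] (H →L[ℂ] H) := (traceClassSubmodule H).subtype

instance : CoeOut (TraceClass H) (H →L[ℂ] H) := ⟨fun A => incl H A⟩

/-- A trace-class operator, as an element of the space of trace-class operators. -/
def mk (A : H →L[ℂ] H) (hA : IsTraceClass A) : TraceClass H := ⟨A, hA⟩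

@[simp] lemma incl_mk (A : H →L[ℂ] H) (hA : IsTraceClass A) : incl H (mk A hA) = A := rfl

lemma isTraceClass (A : TraceClass H) : IsTraceClass (A : H →L[ℂ] H) := Subtype.property A

lemma incl_injective : Function.Injective (incl H) := Subtype.val_injective

/-- The trace norm `tr √(A† A)`. -/
instance : Norm (TraceClass H) where
  norm A := ∑' i, (⟪chosenBasis H i, CFC.abs (A : H →L[ℂ] H) (chosenBasis H i)⟫_ℂ).re

lemma norm_def (A : TraceClass H) :
    ‖A‖ = ∑' i, (⟪chosenBasis H i, CFC.abs (A : H →L[ℂ] H) (chosenBasis H i)⟫_ℂ).re := rfl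

/-- The trace norm can be computed in every orthonormal basis. -/
lemma hasSum_norm {ι : Type*} (A : TraceClass H) (e : HilbertBasis ι ℂ H) :
    HasSum (fun i => (⟪e i, CFC.abs (A : H →L[ℂ] H) (e i)⟫_ℂ).re) ‖A‖ := by
  simp_rw [inner_abs, Complex.ofReal_re]
  have h := hsSum_ne_top_hasSum _ e ((isTraceClass_iff _ e).1 A.isTraceClass)
  have h2 := hsSum_ne_top_hasSum _ _ ((isTraceClass_iff _ (chosenBasis H)).1 A.isTraceClass)
  rw [hsSum_basis _ e (chosenBasis H), ← h2.tsum_eq] at h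
  simpa only [norm_def, inner_abs, Complex.ofReal_re] using h

lemma ofReal_norm_eq (A : TraceClass H) :
    ENNReal.ofReal ‖A‖ = hsSum (sqrtAbs (A : H →L[ℂ] H)) (chosenBasis H) := by
  have h := (isTraceClass_iff _ (chosenBasis H)).1 A.isTraceClass
  have h1 := A.hasSum_norm (chosenBasis H)
  simp_rw [inner_abs, Complex.ofReal_re] at h1
  rw [h1.unique (hsSum_ne_top_hasSum _ _ h), ENNReal.ofReal_toReal h]

lemma norm_nonneg' (A : TraceClass H) : 0 ≤ ‖A‖ := by
  refine (A.hasSum_norm (chosenBasis H)).nonneg fun i => ?_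
  rw [inner_abs, Complex.ofReal_re]
  positivity

lemma eq_zero_of_norm (A : TraceClass H) (h : ‖A‖ = 0) : A = 0 := by
  have h1 := A.ofReal_norm_eq
  rw [h, ENNReal.ofReal_zero] at h1
  have h2 := ENNReal.tsum_eq_zero.1 h1.symm
  have h3 : ∀ i, sqrtAbs (A : H →L[ℂ] H) (chosenBasis H i) = 0 := fun i => by simpa using h2 i
  have h4 : sqrtAbs (A : H →L[ℂ] H) = 0 := by
    refine ContinuousLinearMap.ext_on
      (Submodule.dense_iff_topologicalClosure_eq_top.2 (chosenBasis H).dense_span) ?_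
    rintro _ ⟨i, rfl⟩
    exact h3 i
  have h5 : CFC.abs (A : H →L[ℂ] H) = 0 := by
    ext x
    rw [← sqrtAbs_apply, h4]; rfl
  exact incl_injective (by rw [CFC.abs_eq_zero_iff.1 h5, map_zero])

lemma normCore : NormedSpace.Core ℂ (TraceClass H) where
  norm_nonneg := norm_nonneg'
  norm_smul c A := by
    have h : ENNReal.ofReal ‖c • A‖ = ENNReal.ofReal (‖c‖ * ‖A‖) := by
      rw [ENNReal.ofReal_mul (norm_nonneg c), ofReal_norm_eq, ofReal_norm_eq, map_smul,
        hsSum_sqrtAbs_smul, ofReal_norm]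
    exact (ENNReal.ofReal_eq_ofReal_iff (norm_nonneg' _)
      (mul_nonneg (norm_nonneg _) (norm_nonneg' _))).1 h
  norm_triangle A B := by
    have h : ENNReal.ofReal ‖A + B‖ ≤ ENNReal.ofReal (‖A‖ + ‖B‖) := by
      rw [ENNReal.ofReal_add (norm_nonneg' _) (norm_nonneg' _), ofReal_norm_eq, ofReal_norm_eq,
        ofReal_norm_eq, map_add]
      exact hsSum_sqrtAbs_add_le _ _ _
    exact (ENNReal.ofReal_le_ofReal_iff (add_nonneg (norm_nonneg' _) (norm_nonneg' _))).1 h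
  norm_eq_zero_iff A := by
    refine ⟨eq_zero_of_norm A, ?_⟩
    rintro rfl
    simp [norm_def]

instance : NormedAddCommGroup (TraceClass H) := NormedAddCommGroup.ofCore normCore

instance : NormedSpace ℂ (TraceClass H) := NormedSpace.ofCore normCore

/-- The trace `tr A = ∑ i, ⟪e i, A (e i)⟫`. -/
def trace (A : TraceClass H) : ℂ :=
  ∑' i, ⟪chosenBasis H i, (A : H →L[ℂ] H) (chosenBasis H i)⟫_ℂ

lemma hsSum_add_smul_ne_top {ι : Type*} (e : HilbertBasis ι ℂ H) {P Q : H →L[ℂ] K}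
    (hP : hsSum P e ≠ ∞) (hQ : hsSum Q e ≠ ∞) (c : ℂ) : hsSum (P + c • Q) e ≠ ∞ := by
  refine ne_top_of_le_ne_top (b := 2 * (hsSum P e + ‖c‖ₑ ^ 2 * hsSum Q e)) (by finiteness) ?_
  unfold hsSum
  rw [← ENNReal.tsum_mul_left, ← ENNReal.tsum_add, ← ENNReal.tsum_mul_left]
  refine ENNReal.tsum_le_tsum fun i => ?_
  have h : ‖(P + c • Q) (e i)‖ ^ 2 ≤ 2 * (‖P (e i)‖ ^ 2 + ‖c‖ ^ 2 * ‖Q (e i)‖ ^ 2) := by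
    have h1 : ‖(P + c • Q) (e i)‖ ≤ ‖P (e i)‖ + ‖c‖ * ‖Q (e i)‖ := by
      rw [← norm_smul]; exact norm_add_le _ _
    have h2 := pow_le_pow_left₀ (norm_nonneg _) h1 2
    nlinarith [sq_nonneg (‖P (e i)‖ - ‖c‖ * ‖Q (e i)‖)]
  have h2 := ENNReal.ofReal_le_ofReal h
  rwa [ENNReal.ofReal_mul zero_le_two, ENNReal.ofReal_add (by positivity) (by positivity),
    ENNReal.ofReal_mul (by positivity), ENNReal.ofReal_pow (norm_nonneg _),
    ENNReal.ofReal_pow (norm_nonneg _), ENNReal.ofReal_pow (norm_nonneg _),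
    ENNReal.ofReal_pow (norm_nonneg _), ofReal_norm, ofReal_norm, ofReal_norm, ofReal_norm,
    ENNReal.ofReal_ofNat] at h2

lemma hasSum_inner_of_hsSum {ι : Type*} (e : HilbertBasis ι ℂ H) {P Q : H →L[ℂ] K}
    (hP : hsSum P (chosenBasis H) ≠ ∞) (hQ : hsSum Q (chosenBasis H) ≠ ∞) :
    HasSum (fun i => ⟪P (e i), Q (e i)⟫_ℂ)
      ((((hsSum (P + (1 : ℂ) • Q) (chosenBasis H)).toReal : ℂ) -
        ((hsSum (P + (-1 : ℂ) • Q) (chosenBasis H)).toReal : ℂ) +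
        (((hsSum (P + (-Complex.I) • Q) (chosenBasis H)).toReal : ℂ) -
        ((hsSum (P + Complex.I • Q) (chosenBasis H)).toReal : ℂ)) * Complex.I) / 4) := by
  have h : ∀ c : ℂ, HasSum (fun i => ((‖(P + c • Q) (e i)‖ ^ 2 : ℝ) : ℂ))
      ((hsSum (P + c • Q) (chosenBasis H)).toReal : ℂ) := by
    intro c
    have h1 := hsSum_add_smul_ne_top _ hP hQ c
    rw [hsSum_basis _ _ e] at h1 ⊢
    exact Complex.hasSum_ofReal.2 (hsSum_ne_top_hasSum _ e h1)
  have h2 := (((h 1).sub (h (-1))).add (((h (-Complex.I)).sub (h Complex.I)).mul_right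
    Complex.I)).div_const 4
  have heq : ∀ i, ⟪P (e i), Q (e i)⟫_ℂ = (((‖(P + (1 : ℂ) • Q) (e i)‖ ^ 2 : ℝ) : ℂ) -
      ((‖(P + (-1 : ℂ) • Q) (e i)‖ ^ 2 : ℝ) : ℂ) +
      (((‖(P + (-Complex.I) • Q) (e i)‖ ^ 2 : ℝ) : ℂ) -
      ((‖(P + Complex.I • Q) (e i)‖ ^ 2 : ℝ) : ℂ)) * Complex.I) / 4 := fun i => by
    rw [inner_eq_sum_norm_sq_div_four]
    simp [sub_eq_add_neg]
  simp_rw [heq]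
  exact h2

/-- The sum defining the trace converges in every orthonormal basis, always to the same value. -/
lemma hasSum_trace {ι : Type*} (A : TraceClass H) (e : HilbertBasis ι ℂ H) :
    HasSum (fun i => ⟪e i, (A : H →L[ℂ] H) (e i)⟫_ℂ) A.trace := by
  have hA := (isTraceClass_iff _ (chosenBasis H)).1 A.isTraceClass
  obtain ⟨P, Q, hPQ, hP, hQ⟩ := exists_factor (A : H →L[ℂ] H) (.id ℂ H) (.id ℂ H)
    (chosenBasis H) (chosenBasis H)
  simp only [ContinuousLinearMap.id_apply] at hPQ
  have hP' : hsSum P (chosenBasis H) ≠ ∞ := ne_top_of_le_ne_top (by finiteness) hP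
  have hQ' : hsSum Q (chosenBasis H) ≠ ∞ := ne_top_of_le_ne_top (by finiteness) hQ
  have h1 := hasSum_inner_of_hsSum (chosenBasis H) hP' hQ'
  have h2 := hasSum_inner_of_hsSum e hP' hQ'
  rw [← h1.tsum_eq] at h2
  simpa only [trace, hPQ] using h2

/-- The map `A ↦ X A Y` on trace-class operators, for bounded `X` and `Y`. -/
def sandwich (X : H →L[ℂ] K) (Y : K →L[ℂ] H) : TraceClass H →ₗ[ℂ] TraceClass K where
  toFun A := mk (X ∘L (A : H →L[ℂ] H) ∘L Y) (A.isTraceClass.sandwich X Y)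
  map_add' A B := incl_injective (by ext x; simp)
  map_smul' c A := incl_injective (by ext x; simp)

@[simp] lemma incl_sandwich (X : H →L[ℂ] K) (Y : K →L[ℂ] H) (A : TraceClass H) :
    incl K (sandwich X Y A) = X ∘L (A : H →L[ℂ] H) ∘L Y := rfl

end TraceClass

/-! ### Complete positivity and quantum channels -/

variable (H) in
/-- The Hilbert space `H ⊗ ℂⁿ`, realised as the `ℓ²`-sum of `n` copies of `H`, where `x ⊗ eᵢ` is
the vector with `x` in the `i`-th place and zeros elsewhere. -/
abbrev TensorFin (n : ℕ) : Type u := PiLp 2 fun _ : Fin n => H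

/-- The map `x ↦ x ⊗ eᵢ` from `H` to `H ⊗ ℂⁿ`. -/
def tensorBasis (n : ℕ) (i : Fin n) : H →L[ℂ] TensorFin H n :=
  (PiLp.continuousLinearEquiv 2 ℂ fun _ : Fin n => H).symm.toContinuousLinearMap ∘L
    ContinuousLinearMap.single ℂ (fun _ : Fin n => H) i

/-- The `i`-th coordinate `H ⊗ ℂⁿ → H`, `x ⊗ v ↦ vᵢ x`. -/
def tensorCoord (n : ℕ) (i : Fin n) : TensorFin H n →L[ℂ] H :=
  PiLp.proj 2 (fun _ : Fin n => H) i

/-- `B ⊗ Eᵢⱼ`, where `Eᵢⱼ` is a matrix unit, as a trace-class operator on `H ⊗ ℂⁿ`. -/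
def tensorUnit (n : ℕ) (i j : Fin n) : TraceClass H →ₗ[ℂ] TraceClass (TensorFin H n) :=
  TraceClass.sandwich (tensorBasis n i) (tensorCoord n j)

/-- The block `Aᵢⱼ` of a trace-class operator `A` on `H ⊗ ℂⁿ`, so that `A = ∑ Aᵢⱼ ⊗ Eᵢⱼ`. -/
def tensorBlock (n : ℕ) (i j : Fin n) : TraceClass (TensorFin H n) →ₗ[ℂ] TraceClass H :=
  TraceClass.sandwich (tensorCoord n i) (tensorBasis n j)

/-- The map `T ⊗ idₙ`, which sends `∑ Aᵢⱼ ⊗ Eᵢⱼ` to `∑ T(Aᵢⱼ) ⊗ Eᵢⱼ`. -/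
def ampliation (n : ℕ) (T : TraceClass H →ₗ[ℂ] TraceClass K) :
    TraceClass (TensorFin H n) →ₗ[ℂ] TraceClass (TensorFin K n) :=
  ∑ i, ∑ j, tensorUnit n i j ∘ₗ T ∘ₗ tensorBlock n i j

/-- Every trace-class operator on `H ⊗ ℂⁿ` is the sum of its blocks. -/
lemma sum_tensorUnit_tensorBlock (n : ℕ) (A : TraceClass (TensorFin H n)) :
    ∑ i, ∑ j, tensorUnit n i j (tensorBlock n i j A) = A := by
  have h : ∀ y : TensorFin H n, ∑ i, tensorBasis n i (tensorCoord n i y) = y := by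
    intro y
    ext k
    simp [tensorBasis, tensorCoord, Pi.single_apply]
  refine TraceClass.incl_injective ?_
  ext1 x
  simp only [map_sum, tensorUnit, tensorBlock, TraceClass.incl_sandwich,
    sum_apply, ContinuousLinearMap.comp_apply]
  simp only [← map_sum, h]

/-- `T ⊗ idₙ` acts on elementary tensors as it should. -/
lemma ampliation_tensorUnit (n : ℕ) (T : TraceClass H →ₗ[ℂ] TraceClass K) (i j : Fin n)
    (B : TraceClass H) : ampliation n T (tensorUnit n i j B) = tensorUnit n i j (T B) := by
  have h : ∀ k l, tensorBlock n k l (tensorUnit n i j B) = if k = i ∧ l = j then B else 0 := by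
    intro k l
    refine TraceClass.incl_injective ?_
    ext1 x
    by_cases hk : k = i <;> by_cases hl : l = j <;>
      simp [tensorBlock, tensorUnit, tensorBasis, tensorCoord, hk, hl]
  simp [ampliation, h, ite_and, apply_ite]

/-- A linear map between trace classes is positive if it preserves positive semi-definiteness. -/
def IsPositiveMap (T : TraceClass H →ₗ[ℂ] TraceClass K) : Prop :=
  ∀ A : TraceClass H, (A : H →L[ℂ] H).IsPositive → (T A : K →L[ℂ] K).IsPositive

/-- `T` is completely positive if `T ⊗ idₙ` is positive for every `n`. -/
def IsCompletelyPositive (T : TraceClass H →ₗ[ℂ] TraceClass K) : Prop :=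
  ∀ n : ℕ, IsPositiveMap (ampliation n T)

/-- `T` preserves the trace. -/
def IsTracePreserving (T : TraceClass H →ₗ[ℂ] TraceClass K) : Prop :=
  ∀ A : TraceClass H, (T A).trace = A.trace

variable (H K) in
/-- The set `Q_S(H, K)` of Schrödinger quantum channels: the linear, completely positive and
trace-preserving maps from the trace class of `H` to the trace class of `K`. -/
def schrodingerChannels : Set (TraceClass H →ₗ[ℂ] TraceClass K) :=
  {T | IsCompletelyPositive T ∧ IsTracePreserving T}

variable (H) in
/-- `Q_S(H)` as a set of bounded operators on the normed space of trace-class operators. -/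
def channelOperators : Set (TraceClass H →L[ℂ] TraceClass H) :=
  {T | T.toLinearMap ∈ schrodingerChannels H H}

end QuantumChannel

end

noncomputable section

namespace QuantumChannel

open scoped ComplexOrder

universe u v

variable {H : Type u} [NormedAddCommGroup H] [InnerProductSpace ℂ H] [CompleteSpace H]
variable {K : Type v} [NormedAddCommGroup K] [InnerProductSpace ℂ K] [CompleteSpace K]

/-! Boundedness needs only positivity and trace preservation. On positive operators the trace norm
is the trace (`norm_eq_re_trace`), so such a map preserves the norm there. A general `A` has a polar
decomposition `A = W|A|`, and polarizing it writes `4A` as a combination, with coefficients the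
powers of `i`, of four positive operators of norm at most `4‖A‖` (`exists_positive_decomposition`).
Hence `‖T A‖ ≤ 4‖A‖` (`IsPositiveMap.norm_apply_le`); the constant is not sharp, but any constant
will do.

The algebraic claims hold because `T ↦ T ⊗ idₙ` is linear, multiplicative and unital, and positivity
survives sums, nonnegative multiples and composition.

For closedness, both defining conditions can be read off from the scalars `y (T A)` with `y` a
bounded functional. Trace preservation is an equation for the trace functional. Complete positivity
says that certain finite sums of matrix coefficients of the operators `T Aᵢⱼ` are nonnegative
(`inner_ampliation`). Each is a closed condition once all maps `T ↦ y (T A)` are continuous, so one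
lemma, `isClosed_preimage_channelOperators`, settles all three topologies. -/

/-- In the order of `ℂ`, `0 ≤ z` includes `z.im = 0`, and over `ℂ` a real quadratic form already
forces self-adjointness. Positivity thus becomes a family of closed scalar conditions. -/
lemma isPositive_iff_inner_nonneg (A : H →L[ℂ] H) : A.IsPositive ↔ ∀ x, 0 ≤ ⟪A x, x⟫_ℂ := by
  refine ⟨fun h x => h.inner_nonneg_left x, fun h => ?_⟩
  rw [ContinuousLinearMap.isPositive_iff_complex]
  intro x
  obtain ⟨h1, h2⟩ := Complex.le_def.1 (h x)
  exact ⟨Complex.ext rfl (by simpa using h2), h1⟩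

namespace TraceClass

/-! ### Bounds for the trace and for the maps `A ↦ X A Y` -/

/-- The sum of squares, in place of `2‖X‖‖Y‖`, is inherited from the inequality `2ab ≤ a² + b²`
behind `two_mul_tsum_le`; it suffices for continuity. -/
lemma two_mul_norm_sandwich_le (X : H →L[ℂ] K) (Y : K →L[ℂ] H) (A : TraceClass H) :
    2 * ‖sandwich X Y A‖ ≤ (‖X‖ ^ 2 + ‖Y‖ ^ 2) * ‖A‖ := by
  -- Since `|XAY| = W†XAY` with `‖W†‖ ≤ 1`, the trace norm of `XAY` is a diagonal sum of `(W†X)AY`.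
  obtain ⟨W, hW, -, hWC⟩ := exists_polar (X ∘L (A : H →L[ℂ] H) ∘L Y)
  have h := two_mul_tsum_le (A : H →L[ℂ] H) (W.adjoint ∘L X) Y (chosenBasis K) (chosenBasis H)
  have hX : ‖W.adjoint ∘L X‖ₑ ≤ ‖X‖ₑ := by
    refine enorm_le_iff_norm_le.2 ((ContinuousLinearMap.opNorm_comp_le _ _).trans ?_)
    exact mul_le_of_le_one_left (norm_nonneg _) ((LinearIsometryEquiv.norm_map _ _).le.trans hW)
  have h1 : 2 * hsSum (sqrtAbs (X ∘L (A : H →L[ℂ] H) ∘L Y)) (chosenBasis K) ≤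
      (‖X‖ₑ ^ 2 + ‖Y‖ₑ ^ 2) * hsSum (sqrtAbs (A : H →L[ℂ] H)) (chosenBasis H) := by
    rw [hsSum_sqrtAbs]
    simp_rw [← hWC]
    refine h.trans ?_
    gcongr
  rw [← incl_sandwich, ← ofReal_norm_eq, ← ofReal_norm_eq, ← ofReal_norm, ← ofReal_norm,
    ← ENNReal.ofReal_pow (norm_nonneg _), ← ENNReal.ofReal_pow (norm_nonneg _),
    ← ENNReal.ofReal_add (by positivity) (by positivity), ← ENNReal.ofReal_mul (by positivity),
    ← ENNReal.ofReal_ofNat 2, ← ENNReal.ofReal_mul zero_le_two] at h1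
  exact (ENNReal.ofReal_le_ofReal_iff (by positivity)).1 h1

lemma continuous_sandwich (X : H →L[ℂ] K) (Y : K →L[ℂ] H) : Continuous (sandwich X Y) :=
  AddMonoidHomClass.continuous_of_bound _ ((‖X‖ ^ 2 + ‖Y‖ ^ 2) / 2) fun A => by
    linarith [two_mul_norm_sandwich_le X Y A]

lemma norm_trace_le (A : TraceClass H) : ‖A.trace‖ ≤ ‖A‖ := by
  have h := two_mul_tsum_le (A : H →L[ℂ] H) (.id ℂ H) (.id ℂ H) (chosenBasis H) (chosenBasis H)
  have hone : ‖ContinuousLinearMap.id ℂ H‖ₑ ≤ 1 := by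
    have : ‖ContinuousLinearMap.id ℂ H‖ ≤ 1 := ContinuousLinearMap.norm_id_le
    simpa [← ofReal_norm] using this
  have h2 : 2 * ∑' i, ‖⟪chosenBasis H i, (A : H →L[ℂ] H) (chosenBasis H i)⟫_ℂ‖ₑ ≤
      2 * ENNReal.ofReal ‖A‖ := by
    rw [ofReal_norm_eq]
    refine h.trans ?_
    gcongr
    calc _ ≤ (1 : ℝ≥0∞) ^ 2 + 1 ^ 2 := by gcongr
      _ = 2 := by norm_num
  have h3 := (ENNReal.mul_le_mul_iff_right two_ne_zero ENNReal.ofNat_ne_top).1 h2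
  have h4 : ‖A.trace‖ₑ ≤ ENNReal.ofReal ‖A‖ :=
    enorm_tsum_le_tsum_enorm.trans h3
  rw [← ofReal_norm] at h4
  exact (ENNReal.ofReal_le_ofReal_iff (norm_nonneg _)).1 h4

variable (H) in
/-- The trace as a bounded linear functional. -/
def traceCLM : TraceClass H →L[ℂ] ℂ :=
  LinearMap.mkContinuous
    { toFun := trace
      map_add' := fun A B => by
        refine ((A + B).hasSum_trace (chosenBasis H)).unique ?_
        simpa [inner_add_right] using
          (A.hasSum_trace (chosenBasis H)).add (B.hasSum_trace (chosenBasis H))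
      map_smul' := fun c A => by
        refine ((c • A).hasSum_trace (chosenBasis H)).unique ?_
        simpa [inner_smul_right] using (A.hasSum_trace (chosenBasis H)).mul_left c }
    1 fun A => by simpa using A.norm_trace_le

@[simp] lemma traceCLM_apply (A : TraceClass H) : traceCLM H A = A.trace := rfl

/-- Here `|A| = A`. This is the link through which trace preservation controls the norm. -/
lemma norm_eq_re_trace {A : TraceClass H} (hA : (A : H →L[ℂ] H).IsPositive) :
    ‖A‖ = A.trace.re := by
  have h := A.hasSum_norm (chosenBasis H)
  rw [CFC.abs_of_nonneg _ ((ContinuousLinearMap.nonneg_iff_isPositive _).2 hA)] at h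
  exact h.unique (Complex.hasSum_re (A.hasSum_trace _))

/-- The matrix coefficient `A ↦ ⟪x, A z⟫` as a bounded linear functional. -/
def innerCLM (x z : H) : TraceClass H →L[ℂ] ℂ :=
  -- Compressing `A` between `⟪x, ·⟫` and `c ↦ c • z` gives an operator on `ℂ`, whose trace is the
  -- matrix coefficient; boundedness comes from the two factors.
  traceCLM ℂ ∘L ⟨sandwich (innerSL ℂ x) (ContinuousLinearMap.toSpanSingleton ℂ z),
    continuous_sandwich _ _⟩

lemma innerCLM_apply (x z : H) (A : TraceClass H) :
    innerCLM x z A = ⟪x, (A : H →L[ℂ] H) z⟫_ℂ := by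
  -- As the trace is basis-independent, the one-vector basis of `ℂ` may replace the chosen one.
  let e : HilbertBasis Unit ℂ ℂ := (OrthonormalBasis.singleton Unit ℂ).toHilbertBasis
  have h := (sandwich (innerSL ℂ x) (ContinuousLinearMap.toSpanSingleton ℂ z) A).hasSum_trace e
  refine h.unique ?_
  simp [e, hasSum_unique]

/-! ### The absolute value and the decomposition into positive parts -/

lemma isTraceClass_abs {A : H →L[ℂ] H} (hA : IsTraceClass A) : IsTraceClass (CFC.abs A) := by
  rw [isTraceClass_iff _ (chosenBasis H), sqrtAbs, CFC.abs_of_nonneg _ (CFC.abs_nonneg A)]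
  exact (isTraceClass_iff _ (chosenBasis H)).1 hA

/-- `|A| = √(A† A)` as a trace-class operator. -/
def abs (A : TraceClass H) : TraceClass H :=
  mk (CFC.abs (A : H →L[ℂ] H)) (isTraceClass_abs A.isTraceClass)

@[simp] lemma incl_abs (A : TraceClass H) : incl H A.abs = CFC.abs (A : H →L[ℂ] H) := rfl

lemma isPositive_abs (A : TraceClass H) : (A.abs : H →L[ℂ] H).IsPositive :=
  (ContinuousLinearMap.nonneg_iff_isPositive _).1 (CFC.abs_nonneg _)

@[simp] lemma norm_abs (A : TraceClass H) : ‖A.abs‖ = ‖A‖ := by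
  rw [norm_def, norm_def, incl_abs, CFC.abs_of_nonneg _ (CFC.abs_nonneg _)]

lemma isPositive_sandwich_adjoint {A : TraceClass H} (hA : (A : H →L[ℂ] H).IsPositive)
    (X : H →L[ℂ] K) : (sandwich X X.adjoint A : K →L[ℂ] K).IsPositive :=
  hA.conj_adjoint X

/-- Polarization of `4 A = 4 W |A|` along the polar decomposition. -/
lemma exists_positive_decomposition (A : TraceClass H) : ∃ P : Fin 4 → TraceClass H,
    (∀ k, (P k : H →L[ℂ] H).IsPositive) ∧ (∀ k, ‖P k‖ ≤ 4 * ‖A‖) ∧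
      (4 : ℂ) • A = ∑ k : Fin 4, Complex.I ^ (k : ℕ) • P k := by
  obtain ⟨W, hW, hWA, -⟩ := exists_polar (A : H →L[ℂ] H)
  -- Up to the factor `iᵏ`, the term `Xₖ|A|Xₖ†` contributes `iᵏ(W|A|W† + |A|) + W|A| + i²ᵏ|A|W†`.
  -- Summed over `k`, only `4W|A| = 4A` survives.
  let X : Fin 4 → H →L[ℂ] H := fun k => W + Complex.I ^ (k : ℕ) • .id ℂ H
  have hX : ∀ k, ‖X k‖ ≤ 2 := fun k => by
    refine (norm_add_le _ _).trans ?_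
    rw [norm_smul, norm_pow, Complex.norm_I, one_pow, one_mul]
    linarith [ContinuousLinearMap.norm_id_le (𝕜 := ℂ) (E := H)]
  refine ⟨fun k => sandwich (X k) (X k).adjoint A.abs,
    fun k => isPositive_sandwich_adjoint A.isPositive_abs _, fun k => ?_, ?_⟩
  -- With `‖Xₖ‖ ≤ 2` this reads `2‖Pₖ‖ ≤ (4 + 4)‖A‖`.
  · have h := two_mul_norm_sandwich_le (X k) (X k).adjoint A.abs
    rw [LinearIsometryEquiv.norm_map, norm_abs] at h
    have h2 : ‖X k‖ ^ 2 ≤ 4 := by nlinarith [hX k, norm_nonneg (X k)]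
    nlinarith [norm_nonneg A]
  · refine incl_injective ?_
    ext1 x
    simp only [Fin.sum_univ_four, map_add, map_smul, incl_sandwich, incl_abs, add_apply,
      smul_apply, ContinuousLinearMap.comp_apply, X]
    simp only [map_smul, map_smulₛₗ, ContinuousLinearMap.adjoint_id, smul_apply,
      ContinuousLinearMap.id_apply, hWA]
    simp only [Fin.val_zero, Fin.val_one, Fin.val_two, Fin.isValue, pow_zero, pow_one,
      Complex.I_sq, Complex.I_pow_three, Complex.conj_I, map_neg, map_one,
      show ((3 : Fin 4) : ℕ) = 3 from rfl]
    match_scalars <;> ring_nf <;> simp only [Complex.I_sq] <;> norm_num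

end TraceClass

open TraceClass

/-! ### Positive trace-preserving maps are bounded -/

lemma IsPositiveMap.norm_apply_le {T : TraceClass H →ₗ[ℂ] TraceClass K} (hT : IsPositiveMap T)
    (htr : IsTracePreserving T) (A : TraceClass H) : ‖T A‖ ≤ 4 * ‖A‖ := by
  obtain ⟨P, hP, hPn, hA⟩ := A.exists_positive_decomposition
  have hTP : ∀ k, ‖T (P k)‖ ≤ 4 * ‖A‖ := fun k => by
    rw [norm_eq_re_trace (hT _ (hP k)), htr, ← norm_eq_re_trace (hP k)]
    exact hPn k
  have h : (4 : ℂ) • T A = ∑ k : Fin 4, Complex.I ^ (k : ℕ) • T (P k) := by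
    rw [← map_smul, hA, map_sum]
    simp_rw [map_smul]
  have h2 : ‖(4 : ℂ) • T A‖ ≤ ∑ k : Fin 4, 4 * ‖A‖ := by
    rw [h]
    refine norm_sum_le_of_le _ fun k _ => ?_
    rw [norm_smul, norm_pow, Complex.norm_I, one_pow, one_mul]
    exact hTP k
  rw [norm_smul, Complex.norm_ofNat, Finset.sum_const, Finset.card_univ, Fintype.card_fin,
    nsmul_eq_mul] at h2
  push_cast at h2
  linarith

/-! ### Ampliations -/

/-- The coordinate map is the adjoint of the embedding `x ↦ x ⊗ eᵢ`. -/
lemma inner_tensorBasis (n : ℕ) (i : Fin n) (x : H) (y : TensorFin H n) :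
    ⟪tensorBasis n i x, y⟫_ℂ = ⟪x, tensorCoord n i y⟫_ℂ := by
  rw [PiLp.inner_apply, Finset.sum_eq_single i]
  · simp [tensorBasis, tensorCoord]
  · intro j _ hj
    simp [tensorBasis, hj]
  · simp

/-- This turns positivity of `T ⊗ idₙ` into conditions on finitely many matrix coefficients of `T`
at a time, which is what closedness uses. -/
lemma inner_ampliation (n : ℕ) (T : TraceClass H →ₗ[ℂ] TraceClass K)
    (A : TraceClass (TensorFin H n)) (y : TensorFin K n) :
    ⟪(ampliation n T A : TensorFin K n →L[ℂ] TensorFin K n) y, y⟫_ℂ =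
      ∑ i, ∑ j, ⟪(T (tensorBlock n i j A) : K →L[ℂ] K) (tensorCoord n j y),
        tensorCoord n i y⟫_ℂ := by
  simp only [ampliation, LinearMap.sum_apply, map_sum, sum_apply, sum_inner, LinearMap.comp_apply,
    tensorUnit, incl_sandwich, ContinuousLinearMap.comp_apply, inner_tensorBasis]

lemma ampliation_add (n : ℕ) (S T : TraceClass H →ₗ[ℂ] TraceClass K) :
    ampliation n (S + T) = ampliation n S + ampliation n T := by
  simp only [ampliation, LinearMap.add_comp, LinearMap.comp_add, Finset.sum_add_distrib]

lemma ampliation_smul (n : ℕ) (c : ℂ) (T : TraceClass H →ₗ[ℂ] TraceClass K) :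
    ampliation n (c • T) = c • ampliation n T := by
  simp only [ampliation, LinearMap.smul_comp, LinearMap.comp_smul, Finset.smul_sum]

lemma ampliation_comp (n : ℕ) {L : Type*} [NormedAddCommGroup L] [InnerProductSpace ℂ L]
    [CompleteSpace L] (S : TraceClass K →ₗ[ℂ] TraceClass L) (T : TraceClass H →ₗ[ℂ] TraceClass K) :
    ampliation n (S ∘ₗ T) = ampliation n S ∘ₗ ampliation n T := by
  ext1 A
  rw [LinearMap.comp_apply]
  -- Only the inner ampliation is expanded: the outer one then acts on elementary tensors through
  -- `ampliation_tensorUnit`.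
  rw [show ampliation n T A = ∑ i, ∑ j, tensorUnit n i j (T (tensorBlock n i j A)) by
    simp only [ampliation, LinearMap.sum_apply, LinearMap.comp_apply]]
  simp only [map_sum, ampliation_tensorUnit]
  simp only [ampliation, LinearMap.sum_apply, LinearMap.comp_apply]

lemma ampliation_id (n : ℕ) :
    ampliation n (LinearMap.id : TraceClass H →ₗ[ℂ] TraceClass H) = LinearMap.id := by
  ext1 A
  simp only [ampliation, LinearMap.sum_apply, LinearMap.comp_apply, LinearMap.id_apply,
    sum_tensorUnit_tensorBlock]

/-! ### Completely positive maps -/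

/-- This is the case `n = 1`, where `H ⊗ ℂ¹` is a copy of `H`: `A ⊗ E₀₀` is positive, and testing
its image on `x ⊗ e₀` recovers `⟪T A x, x⟫`. -/
lemma IsCompletelyPositive.isPositiveMap {T : TraceClass H →ₗ[ℂ] TraceClass K}
    (hT : IsCompletelyPositive T) : IsPositiveMap T := by
  intro A hA
  have hB : (tensorUnit 1 0 0 A : TensorFin H 1 →L[ℂ] TensorFin H 1).IsPositive := by
    rw [isPositive_iff_inner_nonneg]
    intro y
    simp only [tensorUnit, incl_sandwich, ContinuousLinearMap.comp_apply, inner_tensorBasis]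
    exact hA.inner_nonneg_left _
  have h := hT 1 _ hB
  rw [ampliation_tensorUnit] at h
  rw [isPositive_iff_inner_nonneg]
  intro x
  have h2 := h.inner_nonneg_left (tensorBasis 1 0 x)
  have h3 : tensorCoord 1 0 (tensorBasis 1 0 x) = x := by simp [tensorCoord, tensorBasis]
  simpa only [tensorUnit, incl_sandwich, ContinuousLinearMap.comp_apply, inner_tensorBasis, h3]
    using h2

lemma IsCompletelyPositive.add {S T : TraceClass H →ₗ[ℂ] TraceClass K}
    (hS : IsCompletelyPositive S) (hT : IsCompletelyPositive T) : IsCompletelyPositive (S + T) := by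
  intro n A hA
  rw [ampliation_add, LinearMap.add_apply, map_add]
  exact (hS n A hA).add (hT n A hA)

lemma IsCompletelyPositive.smul {T : TraceClass H →ₗ[ℂ] TraceClass K}
    (hT : IsCompletelyPositive T) {c : ℂ} (hc : 0 ≤ c) : IsCompletelyPositive (c • T) := by
  intro n A hA
  rw [ampliation_smul, LinearMap.smul_apply, map_smul]
  exact (hT n A hA).smul_of_nonneg hc

lemma IsCompletelyPositive.comp {L : Type*} [NormedAddCommGroup L] [InnerProductSpace ℂ L]
    [CompleteSpace L] {S : TraceClass K →ₗ[ℂ] TraceClass L} {T : TraceClass H →ₗ[ℂ] TraceClass K}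
    (hS : IsCompletelyPositive S) (hT : IsCompletelyPositive T) :
    IsCompletelyPositive (S ∘ₗ T) := by
  intro n A hA
  rw [ampliation_comp]
  exact hS n _ (hT n A hA)

lemma isCompletelyPositive_id :
    IsCompletelyPositive (LinearMap.id : TraceClass H →ₗ[ℂ] TraceClass H) := by
  intro n A hA
  rwa [ampliation_id]

/-! ### The set of quantum channels -/

lemma continuous_of_mem_schrodingerChannels {T : TraceClass H →ₗ[ℂ] TraceClass K}
    (hT : T ∈ schrodingerChannels H K) : Continuous T :=
  AddMonoidHomClass.continuous_of_bound T 4 (hT.1.isPositiveMap.norm_apply_le hT.2)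

lemma convex_channelOperators : Convex ℝ (channelOperators H) := by
  intro S hS T hT a b ha hb hab
  -- Convexity has real weights, while complete positivity is stated for complex-linear maps and
  -- scaled by complex `c ≥ 0`.
  have h : (a • S + b • T).toLinearMap = (a : ℂ) • S.toLinearMap + (b : ℂ) • T.toLinearMap := rfl
  refine ⟨?_, fun A => ?_⟩
  · rw [h]
    exact (hS.1.smul (by exact_mod_cast ha)).add (hT.1.smul (by exact_mod_cast hb))
  · have hS' : (S A).trace = A.trace := hS.2 A
    have hT' : (T A).trace = A.trace := hT.2 A
    rw [h, LinearMap.add_apply, LinearMap.smul_apply, LinearMap.smul_apply, ← traceCLM_apply,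
      map_add, map_smul, map_smul]
    simp only [ContinuousLinearMap.coe_coe, traceCLM_apply, hS', hT', ← add_smul]
    rw [← Complex.ofReal_add, hab, Complex.ofReal_one, one_smul]

lemma comp_mem_channelOperators {S T : TraceClass H →L[ℂ] TraceClass H}
    (hS : S ∈ channelOperators H) (hT : T ∈ channelOperators H) :
    S.comp T ∈ channelOperators H :=
  ⟨hS.1.comp hT.1, fun A => (hS.2 (T A)).trans (hT.2 A)⟩

/-- The quantum channels are closed in every topology for which the functions `T ↦ y (T A)` are
continuous. -/
lemma isClosed_preimage_channelOperators {α : Type*} [TopologicalSpace α]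
    (f : α → TraceClass H →L[ℂ] TraceClass H)
    (hf : ∀ (A : TraceClass H) (y : StrongDual ℂ (TraceClass H)), Continuous fun a => y (f a A)) :
    IsClosed (f ⁻¹' channelOperators H) := by
  -- `innerCLM` has the operator in the linear, second slot, whereas positivity is tested with it in
  -- the first; `star` exchanges the two.
  have heq : f ⁻¹' channelOperators H =
      {a | ∀ (n : ℕ) (A : TraceClass (TensorFin H n)),
        (A : TensorFin H n →L[ℂ] TensorFin H n).IsPositive → ∀ y : TensorFin H n,
          0 ≤ ∑ i, ∑ j, star (innerCLM (tensorCoord n i y) (tensorCoord n j y)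
            (f a (tensorBlock n i j A)))} ∩
      {a | ∀ A : TraceClass H, traceCLM H (f a A) = A.trace} := by
    ext a
    simp only [innerCLM_apply, Complex.star_def, inner_conj_symm]
    refine and_congr (forall_congr' fun n => forall_congr' fun A => imp_congr_right fun _ => ?_)
      Iff.rfl
    rw [isPositive_iff_inner_nonneg]
    simp_rw [inner_ampliation]
    rfl
  rw [heq]
  refine IsClosed.inter ?_ ?_
  · simp only [Set.ofPred_forall]
    refine isClosed_iInter fun n => isClosed_iInter fun A => isClosed_iInter fun _ =>
      isClosed_iInter fun y => isClosed_le continuous_const ?_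
    exact continuous_finsetSum _ fun i _ => continuous_finsetSum _ fun j _ =>
      continuous_star.comp (hf _ _)
  · simp only [Set.ofPred_forall]
    exact isClosed_iInter fun A => isClosed_eq (hf A (traceCLM H)) continuous_const

end QuantumChannel

end

theorem theorem2p1 {H : Type*} [NormedAddCommGroup H] [InnerProductSpace ℂ H] [CompleteSpace H]
    [TopologicalSpace.SeparableSpace H] (hdim : ¬ FiniteDimensional ℂ H) :
    -- every channel is bounded, so that `Q_S(H)` is a subset of `B(B¹(H))`
    (∀ T ∈ QuantumChannel.schrodingerChannels H H, Continuous T) ∧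
    -- it is convex
    Convex ℝ (QuantumChannel.channelOperators H) ∧
    -- it is a semigroup under composition, with unit `id`
    (∀ S ∈ QuantumChannel.channelOperators H, ∀ T ∈ QuantumChannel.channelOperators H,
      S.comp T ∈ QuantumChannel.channelOperators H) ∧
    ContinuousLinearMap.id ℂ (QuantumChannel.TraceClass H) ∈ QuantumChannel.channelOperators H ∧
    -- it is closed in the weak operator topology
    IsClosed {T : QuantumChannel.TraceClass H →WOT[ℂ] QuantumChannel.TraceClass H |
      T.toCLM ∈ QuantumChannel.channelOperators H} ∧
    -- it is closed in the strong operator topology (the topology of pointwise convergence)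
    IsClosed (ContinuousLinearMap.toPointwiseConvergenceCLM ℂ (RingHom.id ℂ)
      (QuantumChannel.TraceClass H) (QuantumChannel.TraceClass H) ''
        QuantumChannel.channelOperators H) ∧
    -- it is closed in the uniform operator topology (the topology of the operator norm)
    IsClosed (QuantumChannel.channelOperators H) := by
  refine ⟨fun T hT => QuantumChannel.continuous_of_mem_schrodingerChannels hT,
    QuantumChannel.convex_channelOperators,
    fun S hS T hT => QuantumChannel.comp_mem_channelOperators hS hT,
    ⟨QuantumChannel.isCompletelyPositive_id, fun _ => rfl⟩,
    QuantumChannel.isClosed_preimage_channelOperators ContinuousLinearMapWOT.toCLM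
      ContinuousLinearMapWOT.continuous_dual_apply, ?_,
    QuantumChannel.isClosed_preimage_channelOperators id fun A y => by fun_prop⟩
  let e := ContinuousLinearMap.toPointwiseConvergenceCLM ℂ (RingHom.id ℂ)
    (QuantumChannel.TraceClass H) (QuantumChannel.TraceClass H)
  -- `e` only changes the topology and `g` undoes it, so the image under `e` is a preimage under
  -- `g`. Continuity of `T ↦ y (T A)` is then that of evaluation at `A` followed by `y`.
  let g : (QuantumChannel.TraceClass H →Lₚₜ[ℂ] QuantumChannel.TraceClass H) →
    QuantumChannel.TraceClass H →L[ℂ] QuantumChannel.TraceClass H := fun T => T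
  have he : Function.LeftInverse g e := fun _ => rfl
  have he' : Function.RightInverse g e := fun _ => rfl
  change IsClosed (e '' _)
  rw [Set.image_eq_preimage_of_inverse he he']
  exact QuantumChannel.isClosed_preimage_channelOperators g fun A y =>
    y.continuous.comp (PointwiseConvergenceCLM.evalCLM (RingHom.id ℂ) _ A).continuous
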